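/- Conventions. For $\rho\in\mathbb C$ with $\operatorname{Re}\rho>0$, $m\in\mathbb N=\{1,2,\dots\}$, $u,v\in\mathbb C$, $\omega>0$ and $f:(0,\infty)\to\mathbb C$ put $$\mathcal M_{\rho,m}[f(x)](u,v,\omega)=\int_0^\infty\frac{e^{-ux-v/x}}{(x^m+\omega^m)^\rho}\,f(\omega x)\,dx .$$ Let $0\le M\le s$ and $0\le N\le r$ be integers, $a_i,b_j\in\mathbb C$, $\alpha_i,\beta_j>0$ $(1\le i\le r,\ 1\le j\le s)$. For $z>0$ the Fox $H$-function is $$H^{M,N}_{r,s}\!\left[z\,\middle|\begin{array}{l}(a_i,\alpha_i)_{1,r}\\(b_j,\beta_j)_{1,s}\end{array}\right]=\frac1{2\pi i}\int_{\mathcal C}\mathcal H(\theta)z^{-\theta}d\theta,\qquad \mathcal H(\theta)=\frac{\prod_{j=1}^{M}\Gamma(b_j+\beta_j\theta)}{\prod_{j=M+1}^{s}\Gamma(1-b_j-\beta_j\theta)}\cdot\frac{\prod_{i=1}^{N}\Gamma(1-a_i-\alpha_i\theta)}{\prod_{i=N+1}^{r}\Gamma(a_i+\alpha_i\theta)},$$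 with empty products equal to $1$. Here $\mathcal C$ is a suitable contour: a piecewise $C^1$ curve from $\gamma-i\infty$ to $\gamma+i\infty$ with bounded derivative, coinciding with the line $\operatorname{Re}\theta=\gamma$ (traversed upwards) outside a bounded part, which has the poles of $\Gamma(b_j+\beta_j\theta)$, $1\le j\le M$, on its left (index $\tfrac12$) and those of $\Gamma(1-a_i-\alpha_i\theta)$, $1\le i\le N$, on its right (index $-\tfrac12$), and along which the integral converges absolutely for all $z>0$. (The index of a point $p\notin\mathcal C$ is $\lim_{R\to\infty}\frac1{2\pi i}\int_{\mathcal C_R}\frac{d\theta}{\theta-p}$, where $\mathcal C_R$ is the part of $\mathcal C$ with parameter in $[-R,R]$, the parameter being $\operatorname{Im}\theta$ on the straight ends.) The $\mathbf H$-transform is $$\mathbf H[g(u)](t)=\int_0^\infty H^{M,N}_{r,s}\!\left[ut\,\middle|\begin{array}{l}(a_i,\alpha_i)_{1,r}\\(b_j,\beta_j)_{1,s}\end{array}\right]g(u)\,du .$$ Corollary. Let $\mathcal C$ be a suitable contour for $H^{M,N}_{r,s}$ that lies in the half-plane $\operatorname{Re}\theta<1$, and let $\kappa\in\mathbb R$ satisfy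 $\kappa\le\operatorname{Re}\theta$ for all $\theta\in\mathcal C$. Let $\operatorname{Re}\rho>0$, $m\in\mathbb N$, $v\in\mathbb C$, $\omega>0$. Let $f$ be piecewise continuous in $(0,\infty)$ (finite one-sided limits at every point, finitely many discontinuities in each compact subinterval) and suppose that, with positive constants $K,T,\beta$, $$|f(x)|\le K\,x^{m\operatorname{Re}\rho}e^{x/\beta}\quad\text{for all }x>T,\qquad \int_0^T x^{\kappa-1}e^{-\omega\operatorname{Re}(v)/x}\,|f(x)|\,dx<\infty .$$ (The second condition holds automatically if, for instance, $\operatorname{Re}v>0$ and $f$ is bounded near $0$.) Let $a\in\mathbb C$ with $\operatorname{Re}a>1/\beta$. Then $\mathcal C$ is also a suitable contour for the function $H^{M,N+1}_{r+1,s}$ whose parameters arise by inserting the pair $(0,1)$ in front of $(a_1,\alpha_1),\dots,(a_r,\alpha_r)$; with both $H$-functions taken along $\mathcal C$, the integrals $\mathcal M_{\rho,m}[e^{-ax}f(x)](u\omega,v,\omega)$ for $u>0$, and the (outer) integrals on the two sides of the following identity, converge absolutely; and $$\mathbf H\Big[\mathcal M_{\rho,m}\big[e^{-ax}f(x)\big](u\omega,v,\omega)\Big](\omega)=\mathcal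 M_{\rho,m}\!\left[\frac{f(x)}{x}\,H^{M,N+1}_{r+1,s}\!\left[\frac{\omega}{x}\,\middle|\begin{array}{c}(0,1),(a_i,\alpha_i)_{1,r}\\(b_j,\beta_j)_{1,s}\end{array}\right]\right](a\omega,v,\omega),$$ where the $\mathbf H$-transform is taken with respect to $u$ and evaluated at $\omega$. -/

import Mathlib

open MeasureTheory Set Filter Topology

noncomputable section

/-- `f` is piecewise continuous in `(0, ∞)`: finite one-sided limits exist at every point, and
every compact subinterval contains only finitely many discontinuities. -/
def PiecewiseContinuous (f : ℝ → ℂ) : Prop :=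
  (∀ x : ℝ, 0 < x →
    (∃ l : ℂ, Tendsto f (𝓝[<] x) (𝓝 l)) ∧ (∃ l : ℂ, Tendsto f (𝓝[>] x) (𝓝 l))) ∧
  ∀ p q : ℝ, 0 < p → p ≤ q → {x : ℝ | x ∈ Icc p q ∧ ¬ ContinuousAt f x}.Finite

/-- The integrand `e^{-ux - v/x} (x^m + ω^m)^{-ρ} f(ωx)` of the `M`-transform. -/
def mIntegrand (ρ : ℂ) (m : ℕ) (f : ℝ → ℂ) (u v : ℂ) (ω : ℝ) (x : ℝ) : ℂ :=
  Complex.exp (-u * (x : ℂ) - v / (x : ℂ)) / ((x ^ m + ω ^ m : ℝ) : ℂ) ^ ρ * f (ω * x)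

/-- The `M`-transform `M_{ρ,m}[f(x)](u, v, ω)`. -/
def mTransform (ρ : ℂ) (m : ℕ) (f : ℝ → ℂ) (u v : ℂ) (ω : ℝ) : ℂ :=
  ∫ x in Ioi (0 : ℝ), mIntegrand ρ m f u v ω x

/-- Parameters of the Fox function `H^{m,n}_{r,s}`. Empty ranges are allowed. The index `i : Fin r`
stands for the `(i+1)`-st pair. -/
structure FoxParams (r s : ℕ) where
  m : ℕ
  n : ℕ
  m_le : m ≤ s
  n_le : n ≤ r
  a : Fin r → ℂ
  α : Fin r → ℝ
  b : Fin s → ℂ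
  β : Fin s → ℝ
  α_pos : ∀ i, 0 < α i
  β_pos : ∀ j, 0 < β j

namespace FoxParams

/-- The Mellin-Barnes kernel of `H^{m,n}_{r,s}`. The Gamma function of Mathlib vanishes at its
poles, so that a factor `1 / Γ` has its correct value `0` there. -/
def kernel {r s : ℕ} (P : FoxParams r s) (θ : ℂ) : ℂ :=
  (∏ j : Fin s with j.val < P.m, Complex.Gamma (P.b j + (P.β j : ℂ) * θ)) /
      (∏ j : Fin s with P.m ≤ j.val, Complex.Gamma (1 - P.b j - (P.β j : ℂ) * θ)) *
    ((∏ i : Fin r with i.val < P.n, Complex.Gamma (1 - P.a i - (P.α i : ℂ) * θ)) /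
      (∏ i : Fin r with P.n ≤ i.val, Complex.Gamma (P.a i + (P.α i : ℂ) * θ)))

/-- The poles of `Γ(b_j + β_j θ)`, `1 ≤ j ≤ m`. -/
def leftPoles {r s : ℕ} (P : FoxParams r s) : Set ℂ :=
  {θ | ∃ j : Fin s, j.val < P.m ∧ ∃ k : ℕ, P.b j + (P.β j : ℂ) * θ = -(k : ℂ)}

/-- The poles of `Γ(1 - a_i - α_i θ)`, `1 ≤ i ≤ n`. -/
def rightPoles {r s : ℕ} (P : FoxParams r s) : Set ℂ :=
  {θ | ∃ i : Fin r, i.val < P.n ∧ ∃ k : ℕ, 1 - P.a i - (P.α i : ℂ) * θ = -(k : ℂ)}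

/-- The parameters of `H^{m,n+1}_{r+1,s}` obtained by inserting the pair `(0, 1)` in front of the
pairs `(a_i, α_i)`. -/
def cons {r s : ℕ} (P : FoxParams r s) : FoxParams (r + 1) s where
  m := P.m
  n := P.n + 1
  m_le := P.m_le
  n_le := Nat.succ_le_succ P.n_le
  a := Fin.cons 0 P.a
  α := Fin.cons 1 P.α
  b := P.b
  β := P.β
  α_pos := by
    intro i
    refine Fin.cases ?_ (fun k => ?_) i
    · simp
    · simpa using P.α_pos k
  β_pos := P.β_pos

end FoxParams

/-- A piecewise continuously differentiable infinite contour from `γ - i∞` to `γ + i∞`, with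
`γ = abscissa`. It may be indented arbitrarily, and is the line `Re θ = γ` outside a bounded
range of the parameter. -/
structure MBContour where
  path : ℝ → ℂ
  abscissa : ℝ
  height : ℝ
  breaks : Finset ℝ
  continuous_path : Continuous path
  contDiffAt_path : ∀ t : ℝ, t ∉ breaks → ContDiffAt ℝ 1 path t
  deriv_bounded : ∃ K : ℝ, ∀ t : ℝ, t ∉ breaks → ‖deriv path t‖ ≤ K
  vertical : ∀ t : ℝ, height ≤ |t| → path t = (abscissa : ℂ) + (t : ℂ) * Complex.I

namespace MBContour

/-- The point `p` lies off the contour and has index `c` with respect to it, where the index is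
`lim_{R → ∞} (2πi)⁻¹ ∫ dθ / (θ - p)` over the part of the contour with parameter in `[-R, R]`.
For an upward vertical line it is `1/2` on the left of the line and `-1/2` on the right. -/
def HasIndex (C : MBContour) (p c : ℂ) : Prop :=
  (∀ t : ℝ, C.path t ≠ p) ∧
  Tendsto (fun R : ℝ => (2 * (Real.pi : ℂ) * Complex.I)⁻¹ *
    ∫ t in (-R)..R, deriv C.path t / (C.path t - p)) atTop (𝓝 c)

/-- `p` lies to the left of the contour. -/
def LeftOf (C : MBContour) (p : ℂ) : Prop := C.HasIndex p (1 / 2)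

/-- `p` lies to the right of the contour. -/
def RightOf (C : MBContour) (p : ℂ) : Prop := C.HasIndex p (-(1 / 2))

/-- The pulled back integrand of the Mellin-Barnes integral. -/
def integrand (C : MBContour) {r s : ℕ} (P : FoxParams r s) (z t : ℝ) : ℂ :=
  P.kernel (C.path t) * (z : ℂ) ^ (-(C.path t)) * deriv C.path t

/-- A contour is suitable for `H^{m,n}_{r,s}` on `(0, ∞)` if it separates the two families of
poles and the Mellin-Barnes integral converges absolutely for all positive arguments. -/
structure IsSuitable (C : MBContour) {r s : ℕ} (P : FoxParams r s) : Prop where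
  left : ∀ p ∈ P.leftPoles, C.LeftOf p
  right : ∀ p ∈ P.rightPoles, C.RightOf p
  integrable : ∀ z : ℝ, 0 < z → Integrable (C.integrand P z)

end MBContour

/-- The Fox function `H^{m,n}_{r,s}(z)`, `z > 0`, as a Mellin-Barnes integral over `C`. -/
def foxH (C : MBContour) {r s : ℕ} (P : FoxParams r s) (z : ℝ) : ℂ :=
  (2 * (Real.pi : ℂ) * Complex.I)⁻¹ * ∫ t : ℝ, C.integrand P z t

/-- The `H`-transform of `g` at `t`. -/
def hTransform (C : MBContour) {r s : ℕ} (P : FoxParams r s) (g : ℝ → ℂ) (t : ℝ) : ℂ :=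
  ∫ x in Ioi (0 : ℝ), foxH C P (x * t) * g x

end

/-! Let `F` be the integrand of the `M`-transform of `f` at `(aω, v, ω)`. The factor `e^{-ax}`,
evaluated at `ωx`, shifts the first argument, so `M[e^{-ax} f](uω, v, ω)` is the Laplace transform
of `F` at `uω` (`mIntegrand_exp_mul`). After the substitution `w = uω` the identity is the Parseval
relation `∫ H · LF = ∫ LH · F`. The Laplace transform of `w^{-θ}` is `Γ(1-θ) x^{θ-1}`, and `Γ(1-θ)`
is exactly the kernel factor of the inserted pair `(0,1)`; hence `LH(x) = x⁻¹ H'(1/x)`, with `H'`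
the enlarged function (`integral_foxH_mul_exp_neg`).

Absolute convergence rests on `κ ≤ Re θ ≤ σ < 1` along the contour. It gives `|H(w)| ≤ A (w^{-κ} +
w^{-σ})`, and Tonelli leaves the integrability of `x^{p-1} |F(x)|` for `p = κ, σ`
(`integrableOn_rpow_mul_mIntegrand`).

The contour stays suitable because `Γ(1-θ)` is bounded on it and the new poles `1, 2, …` lie to its
right. -/

/-! ### Measurability and weighted integrability of the `M`-integrand. -/

theorem PiecewiseContinuous.countable_discontinuities {f : ℝ → ℂ} (hf : PiecewiseContinuous f) :
    {x : ℝ | x ∈ Ioi (0 : ℝ) ∧ ¬ ContinuousAt f x}.Countable := by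
  have h : {x : ℝ | x ∈ Ioi (0 : ℝ) ∧ ¬ ContinuousAt f x} ⊆
      ⋃ n : ℕ, {x : ℝ | x ∈ Icc (1 / ((n : ℝ) + 1)) (n + 1) ∧ ¬ ContinuousAt f x} := by
    rintro x ⟨hx, hd⟩
    have hx : 0 < x := hx
    obtain ⟨n, hn⟩ := exists_nat_one_div_lt hx
    obtain ⟨k, hk⟩ := exists_nat_ge x
    refine mem_iUnion.2 ⟨max n k, ⟨?_, ?_⟩, hd⟩
    · refine le_trans ?_ hn.le
      gcongr
      exact le_max_left _ _
    · have : (k : ℝ) ≤ (max n k : ℕ) := by exact_mod_cast le_max_right _ _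
      linarith
  refine (countable_iUnion fun n => (hf.2 _ _ (by positivity) ?_).countable).mono h
  rw [div_le_iff₀ (by positivity)]
  nlinarith [(Nat.cast_nonneg n : (0 : ℝ) ≤ n)]

theorem PiecewiseContinuous.aestronglyMeasurable {f : ℝ → ℂ} (hf : PiecewiseContinuous f) :
    AEStronglyMeasurable f (volume.restrict (Ioi 0)) := by
  set D := {x : ℝ | x ∈ Ioi (0 : ℝ) ∧ ¬ ContinuousAt f x} with hD
  have hc : D.Countable := hf.countable_discontinuities
  have h1 : ContinuousOn f (Ioi 0 \ D) := by
    intro x hx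
    by_contra hn
    exact hx.2 ⟨hx.1, fun h => hn h.continuousWithinAt⟩
  have h2 := h1.aestronglyMeasurable (μ := volume) (measurableSet_Ioi.diff hc.measurableSet)
  rwa [Measure.restrict_congr_set (sdiff_null_ae_eq_self (hc.measure_zero _))] at h2

theorem PiecewiseContinuous.aestronglyMeasurable_comp_mul_left {f : ℝ → ℂ}
    (hf : PiecewiseContinuous f) {ω : ℝ} (hω : 0 < ω) :
    AEStronglyMeasurable (fun x => f (ω * x)) (volume.restrict (Ioi 0)) := by
  refine PiecewiseContinuous.aestronglyMeasurable ⟨fun x hx => ?_, fun p q hp hpq => ?_⟩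
  · obtain ⟨⟨l, hl⟩, l', hl'⟩ := hf.1 (ω * x) (by positivity)
    refine ⟨⟨l, hl.comp ?_⟩, l', hl'.comp ?_⟩
    · refine tendsto_nhdsWithin_iff.2 ⟨?_, ?_⟩
      · exact (continuous_const_mul ω).continuousAt.tendsto.mono_left nhdsWithin_le_nhds
      · filter_upwards [self_mem_nhdsWithin] with y hy
        exact mul_lt_mul_of_pos_left hy hω
    · refine tendsto_nhdsWithin_iff.2 ⟨?_, ?_⟩
      · exact (continuous_const_mul ω).continuousAt.tendsto.mono_left nhdsWithin_le_nhds
      · filter_upwards [self_mem_nhdsWithin] with y hy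
        exact mul_lt_mul_of_pos_left hy hω
  · have := hf.2 (ω * p) (ω * q) (by positivity) (by gcongr)
    refine Finite.of_finite_image (f := fun x => ω * x) (this.subset ?_)
      (mul_right_injective₀ hω.ne').injOn
    rintro _ ⟨x, ⟨hx, hd⟩, rfl⟩
    refine ⟨⟨mul_le_mul_of_nonneg_left hx.1 hω.le, mul_le_mul_of_nonneg_left hx.2 hω.le⟩,
      fun h => hd ?_⟩
    exact ContinuousAt.comp (f := fun x => ω * x) h (continuous_const_mul ω).continuousAt

theorem aestronglyMeasurable_mIntegrand {f : ℝ → ℂ} (hf : PiecewiseContinuous f) {ω : ℝ}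
    (hω : 0 < ω) (ρ : ℂ) (m : ℕ) (u v : ℂ) :
    AEStronglyMeasurable (mIntegrand ρ m f u v ω) (volume.restrict (Ioi 0)) := by
  refine AEStronglyMeasurable.mul ?_ (hf.aestronglyMeasurable_comp_mul_left hω)
  exact Measurable.aestronglyMeasurable (by fun_prop)

theorem norm_mIntegrand {f : ℝ → ℂ} {ω : ℝ} (hω : 0 < ω) (ρ : ℂ) (m : ℕ) (u v : ℂ) {x : ℝ}
    (hx : 0 < x) :
    ‖mIntegrand ρ m f u v ω x‖ =
      Real.exp (-(u.re * x)) * Real.exp (-(v.re / x)) / (x ^ m + ω ^ m) ^ ρ.re * ‖f (ω * x)‖ := by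
  rw [mIntegrand, norm_mul, norm_div, Complex.norm_exp,
    Complex.norm_cpow_eq_rpow_re_of_pos (by positivity), ← Real.exp_add]
  simp [Complex.div_ofReal_re, sub_eq_add_neg]

/-- Near `0`, `p ≥ κ` makes the weight at most a multiple of `x^{κ-1}`, and `hzero` applies after
dilation by `ω`. Near infinity, `p ≤ 1` bounds the weight, `(x^m + ω^m)^{-Re ρ}` absorbs the power
growth of `f`, and `Re a > 1/β` leaves exponential decay. -/
theorem integrableOn_rpow_mul_mIntegrand {f : ℝ → ℂ} (hf : PiecewiseContinuous f)
    {ρ : ℂ} (hρ : 0 < ρ.re) (m : ℕ) {a v : ℂ} {ω : ℝ} (hω : 0 < ω)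
    {K T β : ℝ} (hK : 0 < K) (hT : 0 < T) (hβ : 0 < β)
    (hbound : ∀ x : ℝ, T < x → ‖f x‖ ≤ K * x ^ ((m : ℝ) * ρ.re) * Real.exp (x / β))
    (ha : 1 / β < a.re) {κ : ℝ}
    (hzero : IntegrableOn
      (fun x : ℝ => x ^ (κ - 1) * Real.exp (-(ω * v.re) / x) * ‖f x‖) (Ioc 0 T))
    {p : ℝ} (hp : κ ≤ p) (hp1 : p ≤ 1) :
    IntegrableOn (fun x : ℝ => x ^ (p - 1) * ‖mIntegrand ρ m f (a * ω) v ω x‖) (Ioi 0) := by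
  have hTω : 0 < T / ω := by positivity
  have hmeas : AEStronglyMeasurable (fun x : ℝ => x ^ (p - 1) * ‖mIntegrand ρ m f (a * ω) v ω x‖)
      (volume.restrict (Ioi 0)) :=
    (Measurable.aestronglyMeasurable (by fun_prop)).mul
      (aestronglyMeasurable_mIntegrand hf hω ρ m _ v).norm
  have hare : 0 < a.re := lt_trans (by positivity) ha
  have hau : (a * (ω : ℂ)).re = a.re * ω := by simp
  rw [← Ioc_union_Ioi_eq_Ioi hTω.le]
  refine IntegrableOn.union ?_ ?_
  · have h1 : IntegrableOn (fun x : ℝ => (ω * x) ^ (κ - 1) *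
        Real.exp (-(ω * v.re) / (ω * x)) * ‖f (ω * x)‖) (Ioc 0 (T / ω)) := by
      have := ((intervalIntegrable_iff_integrableOn_Ioc_of_le hT.le).2 hzero).comp_mul_left (c := ω)
      rw [zero_div] at this
      exact (intervalIntegrable_iff_integrableOn_Ioc_of_le hTω.le).1 this
    refine (h1.const_mul ((T / ω) ^ (p - κ) * ω ^ (1 - κ) / (ω ^ m) ^ ρ.re)).mono'
      (hmeas.mono_measure (Measure.restrict_mono Ioc_subset_Ioi_self le_rfl)) ?_
    filter_upwards [ae_restrict_mem measurableSet_Ioc] with x hx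
    have hx0 : 0 < x := hx.1
    rw [norm_mIntegrand hω ρ m _ v hx0, hau, Real.norm_of_nonneg (by positivity)]
    have e1 : x ^ (p - 1) = x ^ (p - κ) * ω ^ (1 - κ) * (ω * x) ^ (κ - 1) := by
      rw [Real.mul_rpow hω.le hx0.le, show x ^ (p - 1) = x ^ (p - κ) * x ^ (κ - 1) by
        rw [← Real.rpow_add hx0]; ring_nf]
      have : ω ^ (1 - κ) * ω ^ (κ - 1) = 1 := by
        rw [← Real.rpow_add hω]; ring_nf; exact Real.rpow_zero _
      linear_combination (-(x ^ (p - κ) * x ^ (κ - 1))) * this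
    have e2 : -(ω * v.re) / (ω * x) = -(v.re / x) := by field_simp
    rw [e1, e2]
    have e3 : x ^ (p - κ) ≤ (T / ω) ^ (p - κ) :=
      Real.rpow_le_rpow hx0.le hx.2 (by linarith)
    have e4 : Real.exp (-(a.re * ω * x)) ≤ 1 := Real.exp_le_one_iff.2 (by
      have : 0 < a.re * ω * x := by positivity
      linarith)
    have e5 : (ω ^ m) ^ ρ.re ≤ (x ^ m + ω ^ m) ^ ρ.re := by
      gcongr
      linarith [pow_pos hx0 m]
    calc _ ≤ (T / ω) ^ (p - κ) * ω ^ (1 - κ) * (ω * x) ^ (κ - 1) *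
          (1 * Real.exp (-(v.re / x)) / (ω ^ m) ^ ρ.re * ‖f (ω * x)‖) := by gcongr
      _ = _ := by ring
  -- The decay rate left when `e^{-Re(a) ω x}` meets the growth `e^{ωx/β}` of `f(ωx)`.
  · set δ := (a.re - 1 / β) * ω with hδ
    have hδ0 : 0 < δ := mul_pos (by linarith) hω
    refine ((exp_neg_integrableOn_Ioi _ hδ0).const_mul
      ((T / ω) ^ (p - 1) * (Real.exp (|v.re| / (T / ω)) * (K * ω ^ ((m : ℝ) * ρ.re))))).mono'
      (hmeas.mono_measure (Measure.restrict_mono (Ioi_subset_Ioi hTω.le) le_rfl)) ?_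
    filter_upwards [ae_restrict_mem measurableSet_Ioi] with x hx
    have hx : T / ω < x := hx
    have hx0 : 0 < x := hTω.trans hx
    rw [norm_mIntegrand hω ρ m _ v hx0, hau, Real.norm_of_nonneg (by positivity)]
    have b1 : x ^ (p - 1) ≤ (T / ω) ^ (p - 1) :=
      Real.rpow_le_rpow_of_nonpos hTω hx.le (by linarith)
    have b2 : Real.exp (-(v.re / x)) ≤ Real.exp (|v.re| / (T / ω)) := by
      refine Real.exp_le_exp.2 ?_
      rw [← neg_div]
      calc -v.re / x ≤ |v.re| / x := by gcongr; exact neg_le_abs _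
        _ ≤ _ := by gcongr
    have b3 : ‖f (ω * x)‖ ≤ K * (ω * x) ^ ((m : ℝ) * ρ.re) * Real.exp (ω * x / β) :=
      hbound _ (by rwa [div_lt_iff₀' hω] at hx)
    have b4 : x ^ ((m : ℝ) * ρ.re) ≤ (x ^ m + ω ^ m) ^ ρ.re := by
      rw [Real.rpow_mul hx0.le, Real.rpow_natCast]
      gcongr
      linarith [pow_pos hω m]
    have b5 : 0 < x ^ ((m : ℝ) * ρ.re) := by positivity
    calc _ ≤ (T / ω) ^ (p - 1) * (Real.exp (-(a.re * ω * x)) * Real.exp (|v.re| / (T / ω)) /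
          x ^ ((m : ℝ) * ρ.re) * (K * (ω * x) ^ ((m : ℝ) * ρ.re) * Real.exp (ω * x / β))) := by
          gcongr
      _ = (T / ω) ^ (p - 1) * (Real.exp (|v.re| / (T / ω)) * (K * ω ^ ((m : ℝ) * ρ.re))) *
          (Real.exp (-(a.re * ω * x)) * Real.exp (ω * x / β)) := by
          rw [Real.mul_rpow hω.le hx0.le]
          field_simp
      _ = _ := by
          rw [← Real.exp_add]
          congr 2
          rw [hδ]
          ring

/-! ### Effect of the pair `(0,1)` on kernel and poles. -/

theorem FoxParams.kernel_cons {r s : ℕ} (P : FoxParams r s) (θ : ℂ) :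
    P.cons.kernel θ = Complex.Gamma (1 - θ) * P.kernel θ := by
  have h1 : ∏ i : Fin (r + 1) with i.val < P.cons.n,
      Complex.Gamma (1 - P.cons.a i - (P.cons.α i : ℂ) * θ) =
      Complex.Gamma (1 - θ) * ∏ i : Fin r with i.val < P.n,
        Complex.Gamma (1 - P.a i - (P.α i : ℂ) * θ) := by
    rw [Finset.prod_filter, Finset.prod_filter, Fin.prod_univ_succ]
    simp [cons]
  have h2 : ∏ i : Fin (r + 1) with P.cons.n ≤ i.val,
      Complex.Gamma (P.cons.a i + (P.cons.α i : ℂ) * θ) =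
      ∏ i : Fin r with P.n ≤ i.val, Complex.Gamma (P.a i + (P.α i : ℂ) * θ) := by
    rw [Finset.prod_filter, Finset.prod_filter, Fin.prod_univ_succ]
    simp [cons]
  have h3 : ∀ A B G X Y : ℂ, A / B * (G * X / Y) = G * (A / B * (X / Y)) := fun A B G X Y => by
    ring
  rw [kernel, h1, h2]
  exact h3 _ _ _ _ _

theorem FoxParams.rightPoles_cons {r s : ℕ} (P : FoxParams r s) {p : ℂ}
    (hp : p ∈ P.cons.rightPoles) : p ∈ P.rightPoles ∨ ∃ k : ℕ, p = ((k + 1 : ℝ) : ℂ) := by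
  obtain ⟨i, hi, k, hk⟩ := hp
  revert hi hk
  refine Fin.cases ?_ (fun i => ?_) i
  · intro _ hk
    right
    refine ⟨k, ?_⟩
    simp only [cons, Fin.cons_zero] at hk
    push_cast at hk ⊢
    linear_combination -hk
  · intro hi hk
    left
    refine ⟨i, ?_, k, ?_⟩
    · simpa [cons] using hi
    · simpa [cons] using hk

theorem Complex.norm_Gamma_le_Gamma_re {z : ℂ} (hz : 0 < z.re) :
    ‖Complex.Gamma z‖ ≤ Real.Gamma z.re := by
  rw [Complex.Gamma_eq_integral hz, Complex.GammaIntegral, Real.Gamma_eq_integral hz]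
  refine (norm_integral_le_integral_norm _).trans_eq ?_
  refine setIntegral_congr_fun measurableSet_Ioi fun x hx => ?_
  rw [norm_mul, Complex.norm_cpow_eq_rpow_re_of_pos hx, Complex.norm_real,
    Real.norm_of_nonneg (Real.exp_pos _).le]
  simp

/-! ### Index of points right of the contour, and suitability for the enlarged parameters. -/

namespace MBContour

theorem hasDerivAt_path (C : MBContour) {t : ℝ} (ht : t ∉ C.breaks) :
    HasDerivAt C.path (deriv C.path t) t :=
  ((C.contDiffAt_path t ht).differentiableAt (by norm_num)).hasDerivAt

/-- The real part is constant on the straight ends, so its supremum is attained on a compact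
parameter range. This gives a uniform gap below `c`. -/
theorem exists_re_le_lt (C : MBContour) {c : ℝ} (h : ∀ t, (C.path t).re < c) :
    ∃ σ < c, ∀ t, (C.path t).re ≤ σ := by
  have hcont : Continuous fun t => (C.path t).re :=
    Complex.continuous_re.comp C.continuous_path
  obtain ⟨t₀, -, ht₀⟩ := (isCompact_Icc (a := -|C.height|) (b := |C.height|)).exists_isMaxOn
    (nonempty_Icc.2 (by linarith [abs_nonneg C.height])) hcont.continuousOn
  refine ⟨(C.path t₀).re, h t₀, fun t => ?_⟩
  have hmem : ∀ s, |s| ≤ |C.height| → (C.path s).re ≤ (C.path t₀).re := fun s hs =>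
    ht₀ (abs_le.1 hs)
  rcases le_total |t| |C.height| with ht | ht
  · exact hmem t ht
  · have h1 := C.vertical t ((le_abs_self _).trans ht)
    -- The parameter `|height|` lies both in the compact range and on a straight end, so it realises
    -- the abscissa.
    have h2 := C.vertical |C.height| (by rw [abs_abs]; exact le_abs_self _)
    have := hmem |C.height| (by rw [abs_abs])
    rw [h2] at this
    rw [h1]
    simpa using this

theorem ae_norm_deriv_path_le (C : MBContour) :
    ∃ K : ℝ, ∀ᵐ t : ℝ, ‖deriv C.path t‖ ≤ K := by
  obtain ⟨K, hK⟩ := C.deriv_bounded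
  refine ⟨K, ?_⟩
  filter_upwards [C.breaks.countable_toSet.ae_notMem volume] with t ht
  exact hK t (by simpa using ht)

/-- As `p - θ` stays in the right half-plane, the principal `log (p - θ)` is a primitive along the
whole contour; the finitely many breaks do no harm. -/
theorem integral_deriv_div_path_sub (C : MBContour) {p : ℂ} (hp : ∀ t, (C.path t).re < p.re)
    (x y : ℝ) :
    ∫ t in x..y, deriv C.path t / (C.path t - p) =
      Complex.log (p - C.path y) - Complex.log (p - C.path x) := by
  have hslit : ∀ t, p - C.path t ∈ Complex.slitPlane := fun t =>
    Or.inl (by simpa using hp t)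
  have hne : ∀ t, C.path t - p ≠ 0 := fun t h => by
    have := hp t
    rw [sub_eq_zero.1 h] at this
    exact lt_irrefl _ this
  have hcinv : Continuous fun t => (C.path t - p)⁻¹ :=
    (C.continuous_path.sub continuous_const).inv₀ hne
  refine MeasureTheory.integral_eq_of_hasDerivAt_off_countable
    (fun t => Complex.log (p - C.path t)) _ C.breaks.countable_toSet ?_ ?_ ?_
  · exact (Continuous.clog (continuous_const.sub C.continuous_path) hslit).continuousOn
  · intro t ht
    have h1 := ((C.hasDerivAt_path (t := t) (by simpa using ht.2)).const_sub p).clog_real (hslit t)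
    have h2 : deriv C.path t / (C.path t - p) = -deriv C.path t / (p - C.path t) := by
      rw [← neg_sub p, div_neg, neg_div]
    rwa [h2]
  · obtain ⟨K, hK⟩ := C.ae_norm_deriv_path_le
    simp only [div_eq_mul_inv]
    have hm := (measurable_deriv C.path).aestronglyMeasurable (μ := volume)
    have hi := hcinv.intervalIntegrable (μ := volume) x y
    exact ⟨hi.1.bdd_mul (c := K) hm.restrict (ae_restrict_of_ae hK),
      hi.2.bdd_mul (c := K) hm.restrict (ae_restrict_of_ae hK)⟩

theorem tendsto_arg_sub_mul_I {d : ℝ} (hd : 0 < d) :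
    Tendsto (fun R : ℝ => Complex.arg (d - R * Complex.I)) atTop (𝓝 (-(Real.pi / 2))) := by
  have h : ∀ R : ℝ, Complex.arg (d - R * Complex.I) = Real.arctan (-R / d) := fun R => by
    have h1 : |Complex.arg (d - R * Complex.I)| < Real.pi / 2 :=
      Complex.abs_arg_lt_pi_div_two_iff.2 (Or.inl (by simpa using hd))
    rw [← Real.arctan_tan (abs_lt.1 h1).1 (abs_lt.1 h1).2, Complex.tan_arg]
    simp
  simp only [h]
  exact (Real.tendsto_arctan_atBot.mono_right nhdsWithin_le_nhds).comp
    (tendsto_neg_atTop_atBot.atBot_div_const hd)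

/-- Since `p` is real, the values of `p - θ` at the parameters `±R` are conjugate for large `R`. The
difference of logarithms is thus `2i arg(d - iR)`, which tends to `-πi`; division by `2πi` gives
`-1/2`. -/
theorem rightOf_of_forall_re_lt (C : MBContour) {p : ℝ} (hp : ∀ t, (C.path t).re < p) :
    C.RightOf p := by
  refine ⟨fun t h => ?_, ?_⟩
  · have := hp t
    rw [h] at this
    simp at this
  set d := p - C.abscissa with hd
  have hd0 : 0 < d := by
    have := hp |C.height|
    rw [C.vertical |C.height| (by rw [abs_abs]; exact le_abs_self _)] at this
    simp at this
    linarith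
  have key : ∀ᶠ R : ℝ in atTop, (2 * (Real.pi : ℂ) * Complex.I)⁻¹ *
      ∫ t in (-R)..R, deriv C.path t / (C.path t - p) =
      (((Real.pi)⁻¹ * Complex.arg (d - R * Complex.I) : ℝ) : ℂ) := by
    filter_upwards [eventually_ge_atTop |C.height|] with R hR
    have hR0 : 0 ≤ R := (abs_nonneg _).trans hR
    have hh : C.height ≤ |R| := (le_abs_self _).trans (hR.trans (le_abs_self _))
    rw [C.integral_deriv_div_path_sub (p := p) (by simpa using hp), C.vertical R hh,
      C.vertical (-R) (by rwa [abs_neg])]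
    have e1 : (p : ℂ) - (C.abscissa + R * Complex.I) = d - R * Complex.I := by
      rw [hd]; push_cast; ring
    have e2 : (p : ℂ) - (C.abscissa + ((-R : ℝ) : ℂ) * Complex.I) =
        (starRingEnd ℂ) (d - R * Complex.I) := by
      rw [hd]; simp; ring
    have harg : Complex.arg (d - R * Complex.I) ≠ Real.pi := by
      intro h
      have := Complex.arg_eq_pi_iff.1 h
      simp at this
      linarith
    rw [e1, e2, Complex.log_conj _ harg]
    have e3 := Complex.sub_conj (Complex.log (d - R * Complex.I))
    rw [e3, Complex.log_im]
    have := Real.pi_ne_zero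
    have h2 : (Real.pi : ℂ) ≠ 0 := by exact_mod_cast this
    push_cast
    field_simp
  refine Tendsto.congr' (key.mono fun R h => h.symm) ?_
  have h1 := (tendsto_arg_sub_mul_I hd0).const_mul (Real.pi)⁻¹
  have h2 := (Complex.continuous_ofReal.tendsto _).comp h1
  have h3 : (((Real.pi)⁻¹ * -(Real.pi / 2) : ℝ) : ℂ) = -(1 / 2) := by
    rw [show (Real.pi)⁻¹ * -(Real.pi / 2) = -(1 / 2) by field_simp [Real.pi_ne_zero]]
    push_cast
    rfl
  rwa [h3] at h2

theorem integrand_cons (C : MBContour) {r s : ℕ} (P : FoxParams r s) (z t : ℝ) :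
    C.integrand P.cons z t = Complex.Gamma (1 - C.path t) * C.integrand P z t := by
  rw [integrand, integrand, P.kernel_cons]
  ring

/-- `|Γ(z)| ≤ Γ(Re z)` for `Re z > 0`, and here `Re z` stays in the compact subset `[1-σ, 1-κ]` of
`(0,∞)`. -/
theorem exists_norm_Gamma_one_sub_le (C : MBContour) (hC : ∀ t, (C.path t).re < 1) {κ : ℝ}
    (hκ : ∀ t, κ ≤ (C.path t).re) : ∃ G : ℝ, ∀ t, ‖Complex.Gamma (1 - C.path t)‖ ≤ G := by
  obtain ⟨σ, hσ, hle⟩ := C.exists_re_le_lt hC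
  have hcont : ContinuousOn Real.Gamma (Icc (1 - σ) (1 - κ)) := fun x hx =>
    (Real.differentiableAt_Gamma fun n => by
      have h1 := hx.1
      have h2 : (0 : ℝ) ≤ n := n.cast_nonneg
      intro h
      linarith).continuousAt.continuousWithinAt
  obtain ⟨G, hG⟩ := isCompact_Icc.exists_bound_of_continuousOn hcont
  refine ⟨G, fun t => ?_⟩
  have hre : (1 - C.path t).re = 1 - (C.path t).re := by simp
  have hpos : 0 < (1 - C.path t).re := by rw [hre]; linarith [hC t]
  refine le_trans ?_ ((le_abs_self _).trans (hG ((1 - C.path t).re) ?_))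
  · exact Complex.norm_Gamma_le_Gamma_re hpos
  · rw [hre]
    exact ⟨by linarith [hle t], by linarith [hκ t]⟩

theorem continuous_Gamma_one_sub_path (C : MBContour) (hC : ∀ t, (C.path t).re < 1) :
    Continuous fun t => Complex.Gamma (1 - C.path t) := by
  refine continuous_iff_continuousAt.2 fun t => ?_
  refine ContinuousAt.comp (f := fun t => 1 - C.path t) (g := Complex.Gamma) ?_
    (continuous_const.sub C.continuous_path).continuousAt
  refine (Complex.differentiableAt_Gamma _ fun n h => ?_).continuousAt
  have h1 := congrArg Complex.re h
  have h2 : (0 : ℝ) ≤ n := n.cast_nonneg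
  simp at h1
  linarith [hC t]

theorem IsSuitable.cons {C : MBContour} {r s : ℕ} {P : FoxParams r s} (h : C.IsSuitable P)
    (hC : ∀ t, (C.path t).re < 1) {κ : ℝ} (hκ : ∀ t, κ ≤ (C.path t).re) :
    C.IsSuitable P.cons where
  left := h.left
  right p hp := by
    rcases P.rightPoles_cons hp with hp | ⟨k, rfl⟩
    · exact h.right p hp
    · refine C.rightOf_of_forall_re_lt fun t => (hC t).trans_le ?_
      linarith [(k.cast_nonneg : (0 : ℝ) ≤ k)]
  integrable z hz := by
    obtain ⟨G, hG⟩ := C.exists_norm_Gamma_one_sub_le hC hκ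
    simp only [funext (C.integrand_cons P z)]
    exact (h.integrable z hz).bdd_mul (c := G)
      (C.continuous_Gamma_one_sub_path hC).aestronglyMeasurable (ae_of_all _ hG)

end MBContour

/-! ### Growth and Laplace transform of the `H`-function. -/

theorem norm_ofReal_cpow_neg_le {z : ℝ} (hz : 0 < z) {θ : ℂ} {κ σ : ℝ} (hκ : κ ≤ θ.re)
    (hσ : θ.re ≤ σ) : ‖(z : ℂ) ^ (-θ)‖ ≤ z ^ (-κ) + z ^ (-σ) := by
  rw [Complex.norm_cpow_eq_rpow_re_of_pos hz, Complex.neg_re]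
  have h1 : 0 < z ^ (-κ) := Real.rpow_pos_of_pos hz _
  have h2 : 0 < z ^ (-σ) := Real.rpow_pos_of_pos hz _
  rcases le_total 1 z with h | h
  · have := Real.rpow_le_rpow_of_exponent_le h (neg_le_neg hκ)
    linarith
  · have := Real.rpow_le_rpow_of_exponent_ge hz h (neg_le_neg hσ)
    linarith

theorem integrableOn_rpow_neg_mul_exp_neg {p : ℝ} (hp : p < 1) {x : ℝ} (hx : 0 < x) :
    IntegrableOn (fun w : ℝ => w ^ (-p) * Real.exp (-(w * x))) (Ioi 0) := by
  refine (integrableOn_rpow_mul_exp_neg_mul_rpow (s := -p) (by linarith) one_pos hx).congr_fun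
    (fun w _ => ?_) measurableSet_Ioi
  simp only [Real.rpow_one]
  ring_nf

theorem integral_rpow_neg_mul_exp_neg {p : ℝ} (hp : p < 1) {x : ℝ} (hx : 0 < x) :
    ∫ w in Ioi (0 : ℝ), w ^ (-p) * Real.exp (-(w * x)) = Real.Gamma (1 - p) * x ^ (p - 1) := by
  have h := Real.integral_rpow_mul_exp_neg_mul_Ioi (a := 1 - p) (by linarith) hx
  rw [one_div, Real.inv_rpow hx.le, ← Real.rpow_neg hx.le, neg_sub, mul_comm] at h
  rw [← h]
  refine setIntegral_congr_fun measurableSet_Ioi fun w _ => ?_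
  ring_nf

theorem integral_cpow_neg_mul_exp_neg {θ : ℂ} (hθ : θ.re < 1) {x : ℝ} (hx : 0 < x) :
    ∫ w in Ioi (0 : ℝ), (w : ℂ) ^ (-θ) * Complex.exp (-(w * x)) =
      (x : ℂ)⁻¹ * (((1 / x : ℝ) : ℂ) ^ (-θ) * Complex.Gamma (1 - θ)) := by
  have h := Complex.integral_cpow_mul_exp_neg_mul_Ioi (a := 1 - θ) (by simpa using hθ) hx
  have hx' : (1 / x : ℂ) ≠ 0 := by simpa using hx.ne'
  rw [sub_eq_add_neg 1 θ, Complex.cpow_add _ _ hx', Complex.cpow_one] at h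
  rw [show (x : ℂ)⁻¹ * (((1 / x : ℝ) : ℂ) ^ (-θ) * Complex.Gamma (1 - θ)) =
    1 / (x : ℂ) * (1 / (x : ℂ)) ^ (-θ) * Complex.Gamma (1 + -θ) by push_cast; ring_nf, ← h]
  refine setIntegral_congr_fun measurableSet_Ioi fun w _ => ?_
  ring_nf

namespace MBContour

theorem integrand_eq (C : MBContour) {r s : ℕ} (P : FoxParams r s) (z t : ℝ) :
    C.integrand P z t = (z : ℂ) ^ (-(C.path t)) * C.integrand P 1 t := by
  rw [integrand, integrand, Complex.ofReal_one, Complex.one_cpow]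
  ring

theorem norm_integrand_le (C : MBContour) {r s : ℕ} (P : FoxParams r s) {κ σ : ℝ}
    (hκ : ∀ t, κ ≤ (C.path t).re) (hσ : ∀ t, (C.path t).re ≤ σ) {z : ℝ} (hz : 0 < z) (t : ℝ) :
    ‖C.integrand P z t‖ ≤ (z ^ (-κ) + z ^ (-σ)) * ‖C.integrand P 1 t‖ := by
  rw [C.integrand_eq, norm_mul]
  gcongr
  exact norm_ofReal_cpow_neg_le hz (hκ t) (hσ t)

theorem IsSuitable.aestronglyMeasurable_integrand_prod {C : MBContour} {r s : ℕ}
    {P : FoxParams r s} (h : C.IsSuitable P) (μ : Measure ℝ) [SFinite μ] :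
    AEStronglyMeasurable (fun p : ℝ × ℝ => C.integrand P p.1 p.2) (μ.prod volume) := by
  simp only [funext fun p : ℝ × ℝ => C.integrand_eq P p.1 p.2]
  have hpath := C.continuous_path.measurable
  refine AEStronglyMeasurable.mul ?_ (h.integrable 1 one_pos).aestronglyMeasurable.comp_snd
  exact Measurable.aestronglyMeasurable (by fun_prop)

end MBContour

section

variable {r s : ℕ} {P : FoxParams r s} {C : MBContour}

theorem aestronglyMeasurable_foxH (h : C.IsSuitable P) (μ : Measure ℝ) [SFinite μ] :
    AEStronglyMeasurable (foxH C P) μ :=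
  (h.aestronglyMeasurable_integrand_prod μ).integral_prod_right'.const_mul _

theorem exists_norm_foxH_le (h : C.IsSuitable P) {κ σ : ℝ}
    (hκ : ∀ t, κ ≤ (C.path t).re) (hσ : ∀ t, (C.path t).re ≤ σ) :
    ∃ A : ℝ, ∀ z : ℝ, 0 < z → ‖foxH C P z‖ ≤ A * (z ^ (-κ) + z ^ (-σ)) := by
  obtain ⟨c, hc⟩ : ∃ c : ℂ, c = (2 * (Real.pi : ℂ) * Complex.I)⁻¹ := ⟨_, rfl⟩
  refine ⟨‖c‖ * ∫ t, ‖C.integrand P 1 t‖, fun z hz => ?_⟩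
  have h1 : ‖∫ t, C.integrand P z t‖ ≤ ∫ t, (z ^ (-κ) + z ^ (-σ)) * ‖C.integrand P 1 t‖ :=
    norm_integral_le_of_norm_le ((h.integrable 1 one_pos).norm.const_mul _)
      (ae_of_all _ (C.norm_integrand_le P hκ hσ hz))
  rw [integral_const_mul] at h1
  calc ‖foxH C P z‖ = ‖c‖ * ‖∫ t, C.integrand P z t‖ := by rw [foxH, norm_mul, hc]
    _ ≤ ‖c‖ * ((z ^ (-κ) + z ^ (-σ)) * ∫ t, ‖C.integrand P 1 t‖) :=
      mul_le_mul_of_nonneg_left h1 (norm_nonneg c)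
    _ = _ := by ring

/-- Dominated by a product of a function of `w` and a function of `t`; `κ, σ < 1` is what makes the
powers of `w` integrable at `0`. It licenses taking the Laplace transform under the Mellin-Barnes
integral. -/
theorem integrable_integrand_mul_exp_neg (h : C.IsSuitable P) {κ σ : ℝ}
    (hκ : ∀ t, κ ≤ (C.path t).re) (hσ : ∀ t, (C.path t).re ≤ σ) (hσ1 : σ < 1)
    {x : ℝ} (hx : 0 < x) :
    Integrable (fun p : ℝ × ℝ => C.integrand P p.1 p.2 * Complex.exp (-(p.1 * x)))
      ((volume.restrict (Ioi 0)).prod volume) := by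
  have hκ1 : κ < 1 := (hκ 0).trans_lt ((hσ 0).trans_lt hσ1)
  have h1 : Integrable (fun w : ℝ => (w ^ (-κ) + w ^ (-σ)) * Real.exp (-(w * x)))
      (volume.restrict (Ioi 0)) := by
    simp only [add_mul]
    exact Integrable.add (integrableOn_rpow_neg_mul_exp_neg hκ1 hx)
      (integrableOn_rpow_neg_mul_exp_neg hσ1 hx)
  refine (h1.mul_prod (h.integrable 1 one_pos).norm).mono' ?_ ?_
  · exact (h.aestronglyMeasurable_integrand_prod _).mul
      (Measurable.aestronglyMeasurable (by fun_prop))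
  · filter_upwards [Measure.quasiMeasurePreserving_fst.ae (ae_restrict_mem measurableSet_Ioi)]
      with p hp
    have hp : 0 < p.1 := hp
    rw [norm_mul, Complex.norm_exp, mul_right_comm]
    have e : (-((p.1 : ℂ) * x)).re = -(p.1 * x) := by simp
    rw [e]
    gcongr
    exact C.norm_integrand_le P hκ hσ hp p.2

theorem integral_foxH_mul_exp_neg (h : C.IsSuitable P) {κ σ : ℝ}
    (hκ : ∀ t, κ ≤ (C.path t).re) (hσ : ∀ t, (C.path t).re ≤ σ) (hσ1 : σ < 1)
    {x : ℝ} (hx : 0 < x) :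
    ∫ w in Ioi (0 : ℝ), foxH C P w * Complex.exp (-(w * x)) =
      (x : ℂ)⁻¹ * foxH C P.cons (1 / x) := by
  have hint := integrable_integrand_mul_exp_neg h hκ hσ hσ1 hx
  simp only [foxH, mul_assoc _ (integral _ _) (Complex.exp _), ← integral_mul_const]
  rw [integral_const_mul, mul_left_comm, ← integral_const_mul (x : ℂ)⁻¹]
  congr 1
  rw [integral_integral_swap hint]
  refine integral_congr_ae (ae_of_all _ fun t => ?_)
  simp only
  have e : ∀ w : ℝ, C.integrand P w t * Complex.exp (-(w * x)) =
      (w : ℂ) ^ (-(C.path t)) * Complex.exp (-(w * x)) * C.integrand P 1 t := fun w => by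
    rw [C.integrand_eq]
    ring
  simp only [e]
  rw [C.integrand_cons, C.integrand_eq P (1 / x)]
  rw [integral_mul_const, integral_cpow_neg_mul_exp_neg ((hσ t).trans_lt hσ1) hx]
  ring

/-- By Tonelli: integrating the bound `w^{-q} e^{-wx}` over `w` first gives `Γ(1-q) x^{q-1}`, which
is the source of the two weights on `F`. -/
theorem integrable_foxH_mul_exp_neg_mul (h : C.IsSuitable P) {κ σ : ℝ}
    (hκ : ∀ t, κ ≤ (C.path t).re) (hσ : ∀ t, (C.path t).re ≤ σ) (hσ1 : σ < 1)
    {F : ℝ → ℂ} (hF : AEStronglyMeasurable F (volume.restrict (Ioi 0)))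
    (hFκ : IntegrableOn (fun x : ℝ => x ^ (κ - 1) * ‖F x‖) (Ioi 0))
    (hFσ : IntegrableOn (fun x : ℝ => x ^ (σ - 1) * ‖F x‖) (Ioi 0)) :
    Integrable (fun p : ℝ × ℝ => foxH C P p.1 * (Complex.exp (-(p.1 * p.2)) * F p.2))
      ((volume.restrict (Ioi 0)).prod (volume.restrict (Ioi 0))) := by
  have hκ1 : κ < 1 := (hκ 0).trans_lt ((hσ 0).trans_lt hσ1)
  have key : ∀ q : ℝ, q < 1 → IntegrableOn (fun x : ℝ => x ^ (q - 1) * ‖F x‖) (Ioi 0) →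
      Integrable (fun p : ℝ × ℝ => p.1 ^ (-q) * Real.exp (-(p.1 * p.2)) * ‖F p.2‖)
        ((volume.restrict (Ioi 0)).prod (volume.restrict (Ioi 0))) := by
    intro q hq hFq
    have hm : AEStronglyMeasurable
        (fun p : ℝ × ℝ => p.1 ^ (-q) * Real.exp (-(p.1 * p.2)) * ‖F p.2‖)
        ((volume.restrict (Ioi 0)).prod (volume.restrict (Ioi 0))) :=
      (Measurable.aestronglyMeasurable (by fun_prop)).mul hF.comp_snd.norm
    refine (integrable_prod_iff' hm).2 ⟨?_, ?_⟩
    · filter_upwards [ae_restrict_mem measurableSet_Ioi] with x hx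
      exact (integrableOn_rpow_neg_mul_exp_neg hq hx).mul_const _
    · refine (hFq.const_mul (Real.Gamma (1 - q))).congr ?_
      filter_upwards [ae_restrict_mem measurableSet_Ioi] with x hx
      rw [← mul_assoc, ← integral_rpow_neg_mul_exp_neg hq hx, ← integral_mul_const]
      refine setIntegral_congr_fun measurableSet_Ioi fun w hw => ?_
      have hw : 0 < w := hw
      exact (Real.norm_of_nonneg (by positivity)).symm
  obtain ⟨A, hA⟩ := exists_norm_foxH_le h hκ hσ
  refine (((key κ hκ1 hFκ).add (key σ hσ1 hFσ)).const_mul A).mono' ?_ ?_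
  · exact (aestronglyMeasurable_foxH h _).comp_fst.mul
      ((Measurable.aestronglyMeasurable (by fun_prop)).mul hF.comp_snd)
  · filter_upwards [Measure.quasiMeasurePreserving_fst.ae (ae_restrict_mem measurableSet_Ioi)]
      with p hp
    have hp : 0 < p.1 := hp
    rw [norm_mul, norm_mul, Complex.norm_exp]
    have e : (-((p.1 : ℂ) * p.2)).re = -(p.1 * p.2) := by simp
    rw [e]
    calc _ ≤ A * (p.1 ^ (-κ) + p.1 ^ (-σ)) * (Real.exp (-(p.1 * p.2)) * ‖F p.2‖) := by
          gcongr
          exact hA _ hp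
      _ = _ := by
          simp only [Pi.add_apply]
          ring

end

/-! ### The Parseval identity. -/

theorem mIntegrand_exp_mul (ρ : ℂ) (m : ℕ) (f : ℝ → ℂ) (a u v : ℂ) (ω x : ℝ) :
    mIntegrand ρ m (fun x => Complex.exp (-a * (x : ℂ)) * f x) u v ω x =
      Complex.exp (-(u * x)) * mIntegrand ρ m f (a * ω) v ω x := by
  have e : Complex.exp (-u * x - v / x) * Complex.exp (-a * ((ω * x : ℝ) : ℂ)) =
      Complex.exp (-(u * x)) * Complex.exp (-(a * ω) * x - v / x) := by
    rw [← Complex.exp_add, ← Complex.exp_add]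
    congr 1
    push_cast
    ring
  simp only [mIntegrand]
  linear_combination (f (ω * x) / ((x ^ m + ω ^ m : ℝ) : ℂ) ^ ρ) * e

theorem mainTheorem10 {r s : ℕ} (P : FoxParams r s) (C : MBContour)
    (hC : C.IsSuitable P) (hC1 : ∀ t : ℝ, (C.path t).re < 1)
    (ρ : ℂ) (hρ : 0 < ρ.re) (m : ℕ) (hm : 0 < m)
    (a v : ℂ) (ω : ℝ) (hω : 0 < ω)
    (f : ℝ → ℂ) (hf : PiecewiseContinuous f)
    (K T β : ℝ) (hK : 0 < K) (hT : 0 < T) (hβ : 0 < β)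
    (hbound : ∀ x : ℝ, T < x → ‖f x‖ ≤ K * x ^ ((m : ℝ) * ρ.re) * Real.exp (x / β))
    (ha : 1 / β < a.re)
    (κ : ℝ) (hκ : ∀ t : ℝ, κ ≤ (C.path t).re)
    (hzero : IntegrableOn
      (fun x : ℝ => x ^ (κ - 1) * Real.exp (-(ω * v.re) / x) * ‖f x‖) (Ioc 0 T)) :
    C.IsSuitable P.cons ∧
    (∀ u : ℝ, 0 < u → IntegrableOn
      (mIntegrand ρ m (fun x => Complex.exp (-a * (x : ℂ)) * f x) ((u : ℂ) * (ω : ℂ)) v ω)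
      (Ioi 0)) ∧
    IntegrableOn
      (fun u : ℝ => foxH C P (u * ω) *
        mTransform ρ m (fun x => Complex.exp (-a * (x : ℂ)) * f x) ((u : ℂ) * (ω : ℂ)) v ω)
      (Ioi 0) ∧
    IntegrableOn
      (mIntegrand ρ m (fun x => f x / (x : ℂ) * foxH C P.cons (ω / x)) (a * (ω : ℂ)) v ω)
      (Ioi 0) ∧
    hTransform C P
      (fun u : ℝ =>
        mTransform ρ m (fun x => Complex.exp (-a * (x : ℂ)) * f x) ((u : ℂ) * (ω : ℂ)) v ω) ω =
      mTransform ρ m (fun x => f x / (x : ℂ) * foxH C P.cons (ω / x)) (a * (ω : ℂ)) v ω := by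
  obtain ⟨σ, hσ1, hσ⟩ := C.exists_re_le_lt hC1
  have hκσ : κ ≤ σ := (hκ 0).trans (hσ 0)
  set F := mIntegrand ρ m f (a * ω) v ω with hFdef
  have hFm : AEStronglyMeasurable F (volume.restrict (Ioi 0)) :=
    aestronglyMeasurable_mIntegrand hf hω ρ m _ v
  have hFp : ∀ p, κ ≤ p → p ≤ 1 → IntegrableOn (fun x : ℝ => x ^ (p - 1) * ‖F x‖) (Ioi 0) :=
    fun p hp hp1 =>
      integrableOn_rpow_mul_mIntegrand hf hρ m hω hK hT hβ hbound ha hzero hp hp1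
  -- At `p = 1` the weight is trivial.
  have hF1 : IntegrableOn F (Ioi 0) := by
    have := hFp 1 (by linarith) le_rfl
    simp only [sub_self, Real.rpow_zero, one_mul] at this
    exact (integrable_norm_iff hFm).1 this
  have hint := integrable_foxH_mul_exp_neg_mul hC hκ hσ hσ1 hFm (hFp κ le_rfl (by linarith))
    (hFp σ hκσ hσ1.le)
  obtain ⟨Φ, hΦ⟩ : ∃ Φ : ℝ → ℂ, Φ = fun w : ℝ =>
      ∫ x in Ioi (0 : ℝ), foxH C P w * (Complex.exp (-(w * x)) * F x) := ⟨_, rfl⟩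
  have hleft : ∀ u : ℝ, foxH C P (u * ω) *
        mTransform ρ m (fun x => Complex.exp (-a * (x : ℂ)) * f x) ((u : ℂ) * (ω : ℂ)) v ω = Φ (u * ω) := by
    intro u
    simp only [hΦ, mTransform, mIntegrand_exp_mul, integral_const_mul]
    push_cast
    rfl
  -- On the right `f(x)/x` is evaluated at `ωx`: its denominator supplies both `ω⁻¹` and the `x⁻¹`
  -- of the Laplace transform, and the argument `ω/(ωx)` becomes `1/x`.
  have hright : ∀ x ∈ Ioi (0 : ℝ),
      mIntegrand ρ m (fun x => f x / (x : ℂ) * foxH C P.cons (ω / x)) (a * (ω : ℂ)) v ω x =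
      (ω : ℂ)⁻¹ * ∫ w in Ioi (0 : ℝ), foxH C P w * (Complex.exp (-(w * x)) * F x) := by
    intro x hx
    have hx : 0 < x := hx
    simp only [← mul_assoc]
    rw [integral_mul_const, integral_foxH_mul_exp_neg hC hκ hσ hσ1 hx, hFdef, mIntegrand,
      mIntegrand, div_mul_cancel_left₀ hω.ne', ← one_div x]
    push_cast
    ring
  refine ⟨hC.cons hC1 hκ, fun u hu => ?_, ?_, ?_, ?_⟩
  · simp only [funext fun x => mIntegrand_exp_mul ρ m f a ((u : ℂ) * ω) v ω x]
    refine Integrable.bdd_mul (c := 1) hF1 (Measurable.aestronglyMeasurable (by fun_prop)) ?_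
    filter_upwards [ae_restrict_mem measurableSet_Ioi] with x hx
    have hx : 0 < x := hx
    rw [Complex.norm_exp, Real.exp_le_one_iff]
    have : 0 < u * ω * x := by positivity
    simpa using this.le
  · simp only [hleft]
    rw [integrableOn_Ioi_comp_mul_right_iff _ _ hω, zero_mul, hΦ]
    exact hint.integral_prod_left
  · exact IntegrableOn.congr_fun (hint.integral_prod_right.const_mul _)
      (fun x hx => (hright x hx).symm) measurableSet_Ioi
  · rw [hTransform, mTransform, setIntegral_congr_fun measurableSet_Ioi hright]
    simp only [hleft]
    -- The substitution `w = uω` yields the same factor `ω⁻¹` as on the right; Fubini does the rest.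
    rw [integral_comp_mul_right_Ioi _ _ hω, zero_mul, integral_const_mul, hΦ,
      integral_integral_swap hint, Complex.real_smul, Complex.ofReal_inv]
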